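/- A pure $n$-qubit stabilizer state is a pure state $|\phi\rangle\langle\phi|$ (so global phases are ignored) such that $|\phi\rangle$ is, up to scalars, the unique vector fixed by some subgroup of the $n$-qubit Pauli group; the stabilizer polytope $\mathcal S_n$ is the convex hull of all of them. Let $\mathcal E_\gamma$ be the single-qubit amplitude damping channel with Kraus operators $E_0=|0\rangle\langle 0|+\sqrt{1-\gamma}\,|1\rangle\langle 1|$ and $E_1=\sqrt{\gamma}\,|0\rangle\langle 1|$. A pure $n$-qubit stabilizer state $|\phi\rangle\langle\phi|$ is called a magic-insulator under homogeneous local amplitude damping if $\mathcal E_\gamma^{\otimes n}(|\phi\rangle\langle\phi|)\in\mathcal S_n$ for every $\gamma\in[0,1]$. Let $N_{\mathrm{stab}}(n)$ be the number of pure $n$-qubit stabilizer states and $N_{\mathrm{ins}}(n)$ the number of those that are magic-insulators. **Proposition (super-exponential rarity of magic-insulators).** For every $n$, $$N_{\mathrm{stab}}(n)=2^n\prod_{j=1}^n(2^j+1)=2^{n^2/2+O(n)},$$ and $$\frac{N_{\mathrm{ins}}(n)}{N_{\mathrm{stab}}(n)}\le 2^{-n^2/8+O(n)},$$ where each $O(n)$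 denotes a quantity bounded in absolute value by $Cn$ with an absolute constant $C$. -/

import Mathlib

noncomputable section

namespace MagicInsulator

/-- Computational-basis strings `x ∈ {0,1}ⁿ`. -/
abbrev Bits (n : ℕ) : Type := Fin n → Fin 2

/-- State vectors of `n` qubits, written in the computational basis. -/
abbrev Ket (n : ℕ) : Type := Bits n → ℂ

/-- Operators on `n` qubits, written in the computational basis. -/
abbrev Op (n : ℕ) : Type := Matrix (Bits n) (Bits n) ℂ

/-- The tensor product `M 0 ⊗ M 1 ⊗ ⋯ ⊗ M (n - 1)` of single-qubit operators. -/
def tensorOp {n : ℕ} (M : Fin n → Matrix (Fin 2) (Fin 2) ℂ) : Op n :=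
  Matrix.of fun x y => ∏ i, M i (x i) (y i)

/-- The single-qubit Pauli operators `I, X, Y, Z`. -/
def pauli : Fin 4 → Matrix (Fin 2) (Fin 2) ℂ :=
  ![!![1, 0; 0, 1], !![0, 1; 1, 0], !![0, -Complex.I; Complex.I, 0], !![1, 0; 0, -1]]

/-- The `n`-qubit Pauli group: the operators `iᵏ P₁ ⊗ ⋯ ⊗ Pₙ` with each `Pⱼ ∈ {I, X, Y, Z}`. -/
def pauliGroup (n : ℕ) : Set (Op n) :=
  {P | ∃ (k : Fin 4) (p : Fin n → Fin 4), P = Complex.I ^ (k : ℕ) • tensorOp fun j => pauli (p j)}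

/-- `φ` is a (normalized) pure stabilizer state vector: the vectors fixed by some set `G` of Pauli
group elements are exactly the scalar multiples of `φ`. (The set `G` may be replaced by the
subgroup that it generates, which has the same fixed vectors; as `φ ≠ 0` is fixed, that subgroup is
automatically abelian and does not contain `-1`.) -/
def IsStabilizerKet {n : ℕ} (φ : Ket n) : Prop :=
  star φ ⬝ᵥ φ = 1 ∧
    ∃ G ⊆ pauliGroup n, ∀ ψ : Ket n, (∀ P ∈ G, P.mulVec ψ = ψ) ↔ ∃ c : ℂ, ψ = c • φ

/-- The pure stabilizer states as rank-one projectors `|φ⟩⟨φ|`, so that vectors which differ by a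
global phase give the same state. -/
def stabilizerStates (n : ℕ) : Set (Op n) :=
  {ρ | ∃ φ : Ket n, IsStabilizerKet φ ∧ ρ = Matrix.vecMulVec φ (star φ)}

/-- The stabilizer polytope. -/
def stabilizerPolytope (n : ℕ) : Set (Op n) :=
  convexHull ℝ (stabilizerStates n)

/-- The no-jump Kraus operator `|0⟩⟨0| + √(1-γ) |1⟩⟨1|` of amplitude damping. -/
def krausE0 (γ : ℝ) : Matrix (Fin 2) (Fin 2) ℂ :=
  !![1, 0; 0, (Real.sqrt (1 - γ) : ℂ)]

/-- The jump Kraus operator `√γ |0⟩⟨1|` of amplitude damping. -/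
def krausE1 (γ : ℝ) : Matrix (Fin 2) (Fin 2) ℂ :=
  !![0, (Real.sqrt γ : ℂ); 0, 0]

/-- The Kraus branch in which exactly the qubits in `J` undergo the jump. -/
def krausBranch {n : ℕ} (γ : ℝ) (J : Finset (Fin n)) : Op n :=
  tensorOp fun i => if i ∈ J then krausE1 γ else krausE0 γ

/-- Homogeneous local amplitude damping: the `n`-fold tensor power of the single-qubit amplitude
damping channel of strength `γ`. -/
def amplitudeDamping {n : ℕ} (γ : ℝ) (ρ : Op n) : Op n :=
  ∑ J : Finset (Fin n), krausBranch γ J * ρ * (krausBranch γ J).conjTranspose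

/-- The pure stabilizer states that are magic-insulators: they stay in the stabilizer polytope at
every damping strength `γ ∈ [0, 1]`. -/
def magicInsulators (n : ℕ) : Set (Op n) :=
  {ρ | ρ ∈ stabilizerStates n ∧
    ∀ γ ∈ Set.Icc (0 : ℝ) 1, amplitudeDamping γ ρ ∈ stabilizerPolytope n}

/-- The number of pure `n`-qubit stabilizer states. -/
def numStab (n : ℕ) : ℕ := (stabilizerStates n).ncard

/-- The number of pure `n`-qubit magic-insulators. -/
def numIns (n : ℕ) : ℕ := (magicInsulators n).ncard

end MagicInsulator

end

namespace MagicInsulator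

open Matrix Finset

/-! Split off the first qubit. A Pauli operator is then block diagonal or block antidiagonal, with
blocks `Q` and `±Q`. Hence a stabilizer ket is, up to a scalar, `χ ⊕ 0`, `0 ⊕ χ` or `χ ⊕ Pχ`, with
`χ` a stabilizer ket on one qubit fewer and `P` a Pauli operator (`exists_canon`,
`Canon.isStabilized`). The Pauli orbit of `χ` has `2 ^ (n + 2)` elements (`Canon.ncard_orbit`), so
each qubit multiplies the count by `2 + 2 ^ (n + 2)`, which gives the product formula. Recording the
number `k` of doublings, where `2 ^ k` is the size of the support, gives about `2 ^ (kn - k² / 2)`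
kets for each `k` (`ncard_canonKets_le`).

The nonzero amplitudes of a stabilizer ket have equal modulus, so `‖ρ x y‖ ≤ ρ y y` on the whole
polytope. Take `y` of maximal weight in the support. Every jump lowers the weight, so only the
no-jump branch reaches column `y`, and it damps the entry `x y` by `√(1-γ) ^ (|x| + |y|)`. The
inequality then forces `|x| ≥ |y|`: the support of an insulator has constant weight
(`Canon.constant_weight`). The support is affine over `𝔽₂`, and a constant-weight affine set has at
most `2 ^ (n / 2)` points, so `k ≤ n / 2`. There `kn - k² / 2 ≤ 3n² / 8`, against `n² / 2` for all
stabilizer states; the difference is `-n² / 8`. -/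

/-! ### Splitting off the first qubit. -/

/-- The ket `|0⟩ ⊗ a + |1⟩ ⊗ b`. -/
def join {n : ℕ} (a b : Ket n) : Ket (n + 1) :=
  fun x => if x 0 = 0 then a (Fin.tail x) else b (Fin.tail x)

@[simp] theorem join_cons_zero {n : ℕ} (a b : Ket n) (x : Bits n) :
    join a b (Fin.cons 0 x : Bits (n + 1)) = a x := by
  simp [join]

@[simp] theorem join_cons_one {n : ℕ} (a b : Ket n) (x : Bits n) :
    join a b (Fin.cons 1 x : Bits (n + 1)) = b x := by
  simp [join]

theorem forall_bits_succ {n : ℕ} {p : Bits (n + 1) → Prop} :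
    (∀ x, p x) ↔ (∀ x : Bits n, p (Fin.cons 0 x : Bits (n + 1))) ∧
      ∀ x : Bits n, p (Fin.cons 1 x : Bits (n + 1)) := by
  refine ⟨fun h => ⟨fun x => h _, fun x => h _⟩, fun h x => ?_⟩
  rw [← Fin.cons_self_tail x]
  generalize x 0 = c
  fin_cases c
  · exact h.1 _
  · exact h.2 _

theorem exists_join {n : ℕ} (φ : Ket (n + 1)) : ∃ a b, φ = join a b :=
  ⟨fun x => φ (Fin.cons 0 x : Bits (n + 1)), fun x => φ (Fin.cons 1 x : Bits (n + 1)),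
    funext (forall_bits_succ.2 ⟨fun x => by simp, fun x => by simp⟩)⟩

theorem join_inj {n : ℕ} {a b c d : Ket n} : join a b = join c d ↔ a = c ∧ b = d := by
  simp only [funext_iff, forall_bits_succ, join_cons_zero, join_cons_one]

theorem join_zero_zero {n : ℕ} : join (0 : Ket n) 0 = 0 :=
  funext (forall_bits_succ.2 ⟨fun x => by simp, fun x => by simp⟩)

theorem smul_join {n : ℕ} (c : ℂ) (a b : Ket n) : c • join a b = join (c • a) (c • b) :=
  funext (forall_bits_succ.2 ⟨fun x => by simp, fun x => by simp⟩)

theorem sum_bits_succ {n : ℕ} {M : Type*} [AddCommMonoid M] (f : Bits (n + 1) → M) :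
    ∑ x, f x = ∑ x : Bits n, f (Fin.cons 0 x : Bits (n + 1)) +
      ∑ x : Bits n, f (Fin.cons 1 x : Bits (n + 1)) := by
  rw [← (Fin.consEquiv fun _ : Fin (n + 1) => Fin 2).sum_comp, Fintype.sum_prod_type,
    Fin.sum_univ_two]
  rfl

theorem tensorOp_mul {n : ℕ} (M N : Fin n → Matrix (Fin 2) (Fin 2) ℂ) :
    tensorOp M * tensorOp N = tensorOp fun i => M i * N i := by
  ext x y
  simp only [tensorOp, mul_apply, of_apply]
  rw [Finset.prod_univ_sum]
  simp [Finset.prod_mul_distrib]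

theorem tensorOp_smul {n : ℕ} (c : Fin n → ℂ) (M : Fin n → Matrix (Fin 2) (Fin 2) ℂ) :
    tensorOp (fun i => c i • M i) = (∏ i, c i) • tensorOp M := by
  ext x y
  simp [tensorOp, Finset.prod_mul_distrib]

theorem tensorOp_one {n : ℕ} : tensorOp (fun _ : Fin n => 1) = 1 := by
  ext x y
  simp only [tensorOp, of_apply, one_apply, Finset.prod_ite_zero, Finset.prod_const_one, funext_iff,
    Finset.mem_univ, true_implies]

theorem tensorOp_mulVec_join {n : ℕ} (M : Fin (n + 1) → Matrix (Fin 2) (Fin 2) ℂ) (a b : Ket n) :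
    tensorOp M *ᵥ join a b =
      join (M 0 0 0 • tensorOp (fun i => M i.succ) *ᵥ a + M 0 0 1 • tensorOp (fun i => M i.succ) *ᵥ b)
        (M 0 1 0 • tensorOp (fun i => M i.succ) *ᵥ a +
          M 0 1 1 • tensorOp (fun i => M i.succ) *ᵥ b) := by
  refine funext (forall_bits_succ.2 ⟨fun x => ?_, fun x => ?_⟩) <;>
  · simp only [mulVec, dotProduct, sum_bits_succ, tensorOp, of_apply, Fin.prod_univ_succ,
      Fin.cons_zero, Fin.cons_succ, join_cons_zero, join_cons_one, Pi.add_apply, Pi.smul_apply,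
      smul_eq_mul, Finset.mul_sum, mul_assoc]

/-! ### The Pauli group. -/

theorem I_pow_mod (k : ℕ) : Complex.I ^ (k % 4) = Complex.I ^ k :=
  (pow_eq_pow_mod k Complex.I_pow_four).symm

theorem mem_pauliGroup_iff {n : ℕ} {P : Op n} :
    P ∈ pauliGroup n ↔ ∃ (k : ℕ) (p : Fin n → Fin 4),
      P = Complex.I ^ k • tensorOp fun j => pauli (p j) := by
  constructor
  · rintro ⟨k, p, rfl⟩
    exact ⟨k, p, rfl⟩
  · rintro ⟨k, p, rfl⟩
    exact ⟨⟨k % 4, Nat.mod_lt _ (by norm_num)⟩, p, by simp only [I_pow_mod]⟩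

theorem I_pow_smul_mem {n : ℕ} {P : Op n} (hP : P ∈ pauliGroup n) (k : ℕ) :
    Complex.I ^ k • P ∈ pauliGroup n := by
  obtain ⟨l, p, rfl⟩ := mem_pauliGroup_iff.1 hP
  exact mem_pauliGroup_iff.2 ⟨k + l, p, by rw [smul_smul, pow_add]⟩

/-- `s` is a sign. -/
def IsSign (s : ℂ) : Prop := s = 1 ∨ s = -1

theorem IsSign.mul {s t : ℂ} (hs : IsSign s) (ht : IsSign t) : IsSign (s * t) := by
  rcases hs with rfl | rfl <;> rcases ht with rfl | rfl <;> simp [IsSign]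

theorem IsSign.mul_self {s : ℂ} (hs : IsSign s) : s * s = 1 := by
  rcases hs with rfl | rfl <;> simp

theorem IsSign.ne_zero {s : ℂ} (hs : IsSign s) : s ≠ 0 := by
  rcases hs with rfl | rfl <;> simp

theorem IsSign.norm {s : ℂ} (hs : IsSign s) : ‖s‖ = 1 := by
  rcases hs with rfl | rfl <;> simp

theorem sign_smul_mem {n : ℕ} {P : Op n} (hP : P ∈ pauliGroup n) {s : ℂ} (hs : IsSign s) :
    s • P ∈ pauliGroup n := by
  rcases hs with rfl | rfl
  · simpa using hP
  · simpa using I_pow_smul_mem hP 2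

theorem pauli_zero_eq_one : pauli 0 = 1 := by
  ext i j; fin_cases i <;> fin_cases j <;> simp [pauli]

theorem pauli_mul (a b : Fin 4) :
    ∃ (k : ℕ) (c : Fin 4), pauli a * pauli b = Complex.I ^ k • pauli c := by
  have key : ∀ k : ℕ, ∀ c : Fin 4, pauli a * pauli b = Complex.I ^ k • pauli c →
    ∃ (k : ℕ) (c : Fin 4), pauli a * pauli b = Complex.I ^ k • pauli c := fun k c h => ⟨k, c, h⟩
  fin_cases a <;> fin_cases b
  all_goals first
    | (refine key 0 0 ?_; simp [pauli]; done)
    | (refine key 0 1 ?_; simp [pauli]; done)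
    | (refine key 0 2 ?_; simp [pauli]; done)
    | (refine key 0 3 ?_; simp [pauli]; done)
    | (refine key 1 1 ?_; simp [pauli]; done)
    | (refine key 1 2 ?_; simp [pauli]; done)
    | (refine key 1 3 ?_; simp [pauli]; done)
    | (refine key 3 1 ?_; simp [pauli, Complex.I_pow_three]; done)
    | (refine key 3 2 ?_; simp [pauli, Complex.I_pow_three]; done)
    | (refine key 3 3 ?_; simp [pauli, Complex.I_pow_three])

theorem pauli_mul_self (a : Fin 4) : pauli a * pauli a = 1 := by
  fin_cases a <;> (ext i j; fin_cases i <;> fin_cases j <;> simp [pauli])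

theorem pauli_comm (a b : Fin 4) :
    ∃ s, IsSign s ∧ pauli a * pauli b = s • (pauli b * pauli a) := by
  fin_cases a <;> fin_cases b
  all_goals first
    | (refine ⟨1, Or.inl rfl, ?_⟩; simp [pauli]; done)
    | (refine ⟨-1, Or.inr rfl, ?_⟩; simp [pauli])

theorem one_mem_pauliGroup {n : ℕ} : (1 : Op n) ∈ pauliGroup n :=
  mem_pauliGroup_iff.2 ⟨0, fun _ => 0, by simp [pauli_zero_eq_one, tensorOp_one]⟩

theorem mul_mem_pauliGroup {n : ℕ} {P Q : Op n} (hP : P ∈ pauliGroup n) (hQ : Q ∈ pauliGroup n) :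
    P * Q ∈ pauliGroup n := by
  obtain ⟨k, p, rfl⟩ := mem_pauliGroup_iff.1 hP
  obtain ⟨l, q, rfl⟩ := mem_pauliGroup_iff.1 hQ
  choose m c h using pauli_mul
  refine mem_pauliGroup_iff.2 ⟨k + l + ∑ i, m (p i) (q i), fun i => c (p i) (q i), ?_⟩
  rw [smul_mul_smul_comm, tensorOp_mul]
  simp only [h, tensorOp_smul, smul_smul, Finset.prod_pow_eq_pow_sum, pow_add]

theorem exists_pauli_inv {n : ℕ} {P : Op n} (hP : P ∈ pauliGroup n) :
    ∃ P' ∈ pauliGroup n, P' * P = 1 ∧ P * P' = 1 := by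
  obtain ⟨k, p, rfl⟩ := mem_pauliGroup_iff.1 hP
  have h4 : Complex.I ^ k * Complex.I ^ (3 * k) = 1 := by
    rw [← pow_add, show k + 3 * k = 4 * k by ring, pow_mul, Complex.I_pow_four, one_pow]
  refine ⟨Complex.I ^ (3 * k) • tensorOp fun j => pauli (p j),
    mem_pauliGroup_iff.2 ⟨_, p, rfl⟩, ?_, ?_⟩
  · rw [smul_mul_smul_comm, tensorOp_mul, mul_comm, h4]
    simp only [pauli_mul_self, tensorOp_one, one_smul]
  · rw [smul_mul_smul_comm, tensorOp_mul, h4]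
    simp only [pauli_mul_self, tensorOp_one, one_smul]

theorem pauli_mul_self_sign {n : ℕ} {P : Op n} (hP : P ∈ pauliGroup n) :
    ∃ s, IsSign s ∧ P * P = s • 1 := by
  obtain ⟨k, p, rfl⟩ := mem_pauliGroup_iff.1 hP
  refine ⟨Complex.I ^ k * Complex.I ^ k, ?_, ?_⟩
  · rw [← mul_pow, Complex.I_mul_I]
    exact neg_one_pow_eq_or ℂ k
  · rw [smul_mul_smul_comm, tensorOp_mul]
    simp only [pauli_mul_self, tensorOp_one]

theorem pauli_comm_sign {n : ℕ} {P Q : Op n} (hP : P ∈ pauliGroup n) (hQ : Q ∈ pauliGroup n) :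
    ∃ s, IsSign s ∧ P * Q = s • (Q * P) := by
  obtain ⟨k, p, rfl⟩ := mem_pauliGroup_iff.1 hP
  obtain ⟨l, q, rfl⟩ := mem_pauliGroup_iff.1 hQ
  choose s hs h using pauli_comm
  refine ⟨∏ i, s (p i) (q i), Finset.prod_induction _ IsSign (fun _ _ => IsSign.mul) (Or.inl rfl)
    fun i _ => hs _ _, ?_⟩
  rw [smul_mul_smul_comm, tensorOp_mul, smul_mul_smul_comm, tensorOp_mul,
    show (fun i => pauli (p i) * pauli (q i)) =
      fun i => s (p i) (q i) • (pauli (q i) * pauli (p i)) from funext fun i => h _ _, tensorOp_smul,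
    smul_comm, mul_comm]

/-! ### Block form of Pauli operators. -/

/-- `P` is the block diagonal operator with blocks `Q` and `s Q`. -/
def IsDiagBlock {n : ℕ} (P : Op (n + 1)) (Q : Op n) (s : ℂ) : Prop :=
  ∀ a b, P *ᵥ join a b = join (Q *ᵥ a) (s • Q *ᵥ b)

/-- `P` is the block antidiagonal operator with blocks `Q` and `s Q`. -/
def IsAntiBlock {n : ℕ} (P : Op (n + 1)) (Q : Op n) (s : ℂ) : Prop :=
  ∀ a b, P *ᵥ join a b = join (Q *ᵥ b) (s • Q *ᵥ a)

theorem pauli_block {n : ℕ} {P : Op (n + 1)} (hP : P ∈ pauliGroup (n + 1)) :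
    ∃ Q ∈ pauliGroup n, ∃ s, IsSign s ∧ (IsDiagBlock P Q s ∨ IsAntiBlock P Q s) := by
  obtain ⟨k, p, rfl⟩ := mem_pauliGroup_iff.1 hP
  have hT : ∀ l : ℕ, Complex.I ^ l • tensorOp (fun i : Fin n => pauli (p i.succ)) ∈ pauliGroup n :=
    fun l => mem_pauliGroup_iff.2 ⟨l, _, rfl⟩
  have h4 : p 0 = 0 ∨ p 0 = 1 ∨ p 0 = 2 ∨ p 0 = 3 := by
    generalize p 0 = c; fin_cases c <;> simp
  rcases h4 with h | h | h | h
  · refine ⟨_, hT k, 1, Or.inl rfl, Or.inl fun a b => ?_⟩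
    simp [smul_mulVec, tensorOp_mulVec_join, smul_join, h, pauli]
  · refine ⟨_, hT k, 1, Or.inl rfl, Or.inr fun a b => ?_⟩
    simp [smul_mulVec, tensorOp_mulVec_join, smul_join, h, pauli]
  -- The upper entry `-i = i ^ 3` of `Y` is absorbed into `Q`, which leaves the relative sign `-1`.
  · refine ⟨_, hT (k + 3), -1, Or.inr rfl, Or.inr fun a b => ?_⟩
    simp [smul_mulVec, tensorOp_mulVec_join, smul_join, h, pauli, pow_add, smul_smul,
      Complex.I_pow_three, neg_mulVec]
  · refine ⟨_, hT k, -1, Or.inr rfl, Or.inl fun a b => ?_⟩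
    simp [smul_mulVec, tensorOp_mulVec_join, smul_join, h, pauli]

theorem exists_pauli_diag {n : ℕ} {Q : Op n} (hQ : Q ∈ pauliGroup n) {s : ℂ} (hs : IsSign s) :
    ∃ P ∈ pauliGroup (n + 1), IsDiagBlock P Q s := by
  obtain ⟨k, p, rfl⟩ := mem_pauliGroup_iff.1 hQ
  rcases hs with rfl | rfl
  · refine ⟨_, mem_pauliGroup_iff.2 ⟨k, Fin.cons 0 p, rfl⟩, fun a b => ?_⟩
    simp [smul_mulVec, tensorOp_mulVec_join, smul_join, pauli]
  · refine ⟨_, mem_pauliGroup_iff.2 ⟨k, Fin.cons 3 p, rfl⟩, fun a b => ?_⟩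
    simp [smul_mulVec, tensorOp_mulVec_join, smul_join, pauli]

theorem exists_pauli_anti {n : ℕ} {Q : Op n} (hQ : Q ∈ pauliGroup n) {s : ℂ} (hs : IsSign s) :
    ∃ P ∈ pauliGroup (n + 1), IsAntiBlock P Q s := by
  obtain ⟨k, p, rfl⟩ := mem_pauliGroup_iff.1 hQ
  rcases hs with rfl | rfl
  · refine ⟨_, mem_pauliGroup_iff.2 ⟨k, Fin.cons 1 p, rfl⟩, fun a b => ?_⟩
    simp [smul_mulVec, tensorOp_mulVec_join, smul_join, pauli]
  · refine ⟨_, mem_pauliGroup_iff.2 ⟨k + 1, Fin.cons 2 p, rfl⟩, fun a b => ?_⟩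
    simp [smul_mulVec, tensorOp_mulVec_join, smul_join, pauli, pow_add, smul_smul, mul_assoc]

/-- A Pauli operator permutes the computational basis by a translation, up to phases. -/
theorem exists_norm_pauli_mulVec {n : ℕ} {P : Op n} (hP : P ∈ pauliGroup n) :
    ∃ a : Bits n, ∀ ψ x, ‖(P *ᵥ ψ) x‖ = ‖ψ (x + a)‖ := by
  induction n with
  | zero =>
    obtain ⟨k, p, rfl⟩ := mem_pauliGroup_iff.1 hP
    refine ⟨0, fun ψ x => ?_⟩
    simp only [mulVec, dotProduct, tensorOp, Finset.univ_unique, Finset.sum_singleton,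
      Finset.univ_eq_empty, Finset.prod_empty, of_apply, Matrix.smul_apply, smul_eq_mul, mul_one, norm_mul,
      norm_pow, Complex.norm_I, one_pow, one_mul]
    exact congrArg (fun y => ‖ψ y‖) (Subsingleton.elim _ _)
  | succ n ih =>
    obtain ⟨Q, hQ, s, hs, h | h⟩ := pauli_block hP
    · obtain ⟨a, ha⟩ := ih hQ
      refine ⟨Fin.cons 0 a, fun ψ => ?_⟩
      obtain ⟨φ, χ, rfl⟩ := exists_join ψ
      rw [h]
      have e : ∀ (c : Fin 2) (x : Bits n), (Fin.cons c x : Bits (n + 1)) + Fin.cons 0 a =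
          (Fin.cons c (x + a) : Bits (n + 1)) := fun c x => by
        ext i; refine Fin.cases ?_ (fun i => ?_) i <;> simp
      refine forall_bits_succ.2 ⟨fun x => ?_, fun x => ?_⟩ <;> rw [e] <;> simp [ha, hs.norm]
    · obtain ⟨a, ha⟩ := ih hQ
      refine ⟨Fin.cons 1 a, fun ψ => ?_⟩
      obtain ⟨φ, χ, rfl⟩ := exists_join ψ
      rw [h]
      have e : ∀ (c : Fin 2) (x : Bits n), (Fin.cons c x : Bits (n + 1)) + Fin.cons 1 a =
          (Fin.cons (c + 1) (x + a) : Bits (n + 1)) := fun c x => by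
        ext i; refine Fin.cases ?_ (fun i => ?_) i <;> simp
      refine forall_bits_succ.2 ⟨fun x => ?_, fun x => ?_⟩ <;> rw [e]
      · simp [ha]
      · rw [show (1 : Fin 2) + 1 = 0 from rfl]
        simp [ha, hs.norm]

/-! ### Recursive structure of stabilizer kets. -/

/-- Every Pauli operator that fixes `φ` fixes `ψ`. -/
def FixedWith {n : ℕ} (φ ψ : Ket n) : Prop :=
  ∀ P ∈ pauliGroup n, P *ᵥ φ = φ → P *ᵥ ψ = ψ

/-- `φ` is determined, up to scalars, by the Pauli operators that fix it. -/
def IsStabilized {n : ℕ} (φ : Ket n) : Prop :=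
  ∀ ψ, FixedWith φ ψ → ∃ c : ℂ, ψ = c • φ

/-- Enlarging `G` to all Pauli operators that fix `φ` can only shrink the common fixed space, which
still contains the line through `φ`. -/
theorem isStabilizerKet_iff {n : ℕ} {φ : Ket n} :
    IsStabilizerKet φ ↔ star φ ⬝ᵥ φ = 1 ∧ IsStabilized φ := by
  refine and_congr_right fun _ => ⟨?_, fun h => ?_⟩
  · rintro ⟨G, hG, h⟩ ψ hψ
    exact (h ψ).1 fun P hP => hψ P (hG hP) ((h φ).2 ⟨1, (one_smul _ _).symm⟩ P hP)
  · refine ⟨{P | P ∈ pauliGroup n ∧ P *ᵥ φ = φ}, fun P hP => hP.1, fun ψ => ⟨fun hψ => ?_, ?_⟩⟩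
    · exact h ψ fun P hP hφ => hψ P ⟨hP, hφ⟩
    · rintro ⟨c, rfl⟩ P ⟨-, hP⟩
      rw [mulVec_smul, hP]

theorem FixedWith.mulVec_eq {n : ℕ} {φ ψ : Ket n} (h : FixedWith φ ψ) {P Q : Op n}
    (hP : P ∈ pauliGroup n) (hQ : Q ∈ pauliGroup n) (e : P *ᵥ φ = Q *ᵥ φ) : P *ᵥ ψ = Q *ᵥ ψ := by
  obtain ⟨P', hP', h1, h2⟩ := exists_pauli_inv hP
  have := h (P' * Q) (mul_mem_pauliGroup hP' hQ)
    (by rw [← mulVec_mulVec, ← e, mulVec_mulVec, h1, one_mulVec])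
  rw [← this, mulVec_mulVec, ← mul_assoc, h2, one_mul, this]

theorem IsStabilized.smul {n : ℕ} {φ : Ket n} (h : IsStabilized φ) {c : ℂ} (hc : c ≠ 0) :
    IsStabilized (c • φ) := by
  intro ψ hψ
  obtain ⟨d, rfl⟩ := h ψ fun P hP e => hψ P hP (by rw [mulVec_smul, e])
  exact ⟨d / c, by rw [smul_smul, div_mul_cancel₀ _ hc]⟩

/-- The stabilizer kets, normalized to have leading coefficient `1`, with support of size `2 ^ k`. -/
inductive Canon : (n k : ℕ) → Ket n → Prop
  | one : Canon 0 0 1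
  | left {n k : ℕ} {χ : Ket n} : Canon n k χ → Canon (n + 1) k (join χ 0)
  | right {n k : ℕ} {χ : Ket n} : Canon n k χ → Canon (n + 1) k (join 0 χ)
  | both {n k : ℕ} {χ : Ket n} {P : Op n} : Canon n k χ → P ∈ pauliGroup n →
      Canon (n + 1) (k + 1) (join χ (P *ᵥ χ))

/-- The coefficient of the first basis state in the support of a ket. -/
noncomputable def lead : {n : ℕ} → Ket n → ℂ
  | 0, φ => φ ![]
  | n + 1, φ =>
    haveI := Classical.propDecidable
    if (fun x : Bits n => φ (Fin.cons 0 x : Bits (n + 1))) = 0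
      then lead fun x : Bits n => φ (Fin.cons 1 x : Bits (n + 1))
      else lead fun x : Bits n => φ (Fin.cons 0 x : Bits (n + 1))

theorem lead_join {n : ℕ} (a b : Ket n) [Decidable (a = 0)] :
    lead (join a b) = if a = 0 then lead b else lead a := by
  simp only [lead, join_cons_zero, join_cons_one]

theorem lead_smul {n : ℕ} (φ : Ket n) {c : ℂ} (hc : c ≠ 0) : lead (c • φ) = c * lead φ := by
  classical
  induction n with
  | zero => rfl
  | succ n ih =>
    obtain ⟨a, b, rfl⟩ := exists_join φ
    rw [smul_join, lead_join, lead_join]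
    by_cases h : a = 0
    · simp [h, ih]
    · simp [h, ih, hc]

theorem pauli_mulVec_ne_zero {n : ℕ} {P : Op n} (hP : P ∈ pauliGroup n) {φ : Ket n} (h : φ ≠ 0) :
    P *ᵥ φ ≠ 0 := by
  obtain ⟨P', -, h1, -⟩ := exists_pauli_inv hP
  intro e
  apply h
  rw [← one_mulVec φ, ← h1, ← mulVec_mulVec, e, mulVec_zero]

theorem join_left_ne_zero {n : ℕ} {a b : Ket n} (h : a ≠ 0) : join a b ≠ 0 := by
  rw [← join_zero_zero, Ne, join_inj]
  exact fun e => h e.1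

theorem join_right_ne_zero {n : ℕ} {a b : Ket n} (h : b ≠ 0) : join a b ≠ 0 := by
  rw [← join_zero_zero, Ne, join_inj]
  exact fun e => h e.2

theorem Canon.ne_zero {n k : ℕ} {χ : Ket n} (h : Canon n k χ) : χ ≠ 0 := by
  induction h with
  | one => exact one_ne_zero
  | left _ ih => exact join_left_ne_zero ih
  | right _ ih => exact join_right_ne_zero ih
  | both _ _ ih => exact join_left_ne_zero ih

/-- This fixes the scalar left free by a projector, so distinct canonical kets will give distinct
states. -/
theorem Canon.lead_eq_one {n k : ℕ} {χ : Ket n} (h : Canon n k χ) : lead χ = 1 := by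
  classical
  induction h with
  | one => rfl
  | left h ih => rw [lead_join, if_neg h.ne_zero, ih]
  | right _ ih => rw [lead_join, if_pos rfl, ih]
  | both h _ ih => rw [lead_join, if_neg h.ne_zero, ih]

/-- In the one-block cases a diagonal Pauli with blocks `±1` kills the empty block. For `χ ⊕ Rχ`, a
Pauli `Q` fixing `χ` commutes with `R` up to a sign `s`, so the diagonal Pauli with blocks `Q`, `sQ`
fixes the ket; an antidiagonal one then ties the lower block to the upper. -/
theorem Canon.isStabilized {n k : ℕ} {χ : Ket n} (h : Canon n k χ) : IsStabilized χ := by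
  induction h with
  | one =>
    intro ψ _
    exact ⟨ψ ![], funext fun x => by simp [Subsingleton.elim x ![]]⟩
  | @left n k χ h ih =>
    intro ψ hψ
    obtain ⟨a, b, rfl⟩ := exists_join ψ
    have fix : ∀ Q ∈ pauliGroup n, ∀ s, IsSign s → Q *ᵥ χ = χ → Q *ᵥ a = a ∧ s • Q *ᵥ b = b := by
      intro Q hQ s hs e
      obtain ⟨P, hP, hPQ⟩ := exists_pauli_diag hQ hs
      have := hψ P hP (by rw [hPQ, e, mulVec_zero, smul_zero])
      rwa [hPQ, join_inj] at this
    have hb := (fix 1 one_mem_pauliGroup (-1) (Or.inr rfl) (one_mulVec _)).2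
    obtain ⟨c, rfl⟩ := ih a fun Q hQ e => (fix Q hQ 1 (Or.inl rfl) e).1
    refine ⟨c, ?_⟩
    rw [one_mulVec, neg_smul, one_smul, neg_eq_self] at hb
    rw [smul_join, smul_zero, hb]
  | @right n k χ h ih =>
    intro ψ hψ
    obtain ⟨a, b, rfl⟩ := exists_join ψ
    have fix : ∀ Q ∈ pauliGroup n, ∀ s, IsSign s → s • Q *ᵥ χ = χ → Q *ᵥ a = a ∧ s • Q *ᵥ b = b := by
      intro Q hQ s hs e
      obtain ⟨P, hP, hPQ⟩ := exists_pauli_diag hQ hs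
      have := hψ P hP (by rw [hPQ, e, mulVec_zero])
      rwa [hPQ, join_inj] at this
    have ha := (fix (-1) (by simpa using sign_smul_mem (n := n) one_mem_pauliGroup (Or.inr rfl)) (-1)
      (Or.inr rfl) (by simp [neg_mulVec])).1
    obtain ⟨c, rfl⟩ := ih b fun Q hQ e => by
      simpa using (fix Q hQ 1 (Or.inl rfl) (by simpa using e)).2
    refine ⟨c, ?_⟩
    rw [neg_mulVec, one_mulVec, neg_eq_self] at ha
    rw [smul_join, smul_zero, ha]
  | @both n k χ R h hR ih =>
    intro ψ hψ
    obtain ⟨a, b, rfl⟩ := exists_join ψ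
    obtain ⟨c, rfl⟩ := ih a fun Q hQ e => by
      obtain ⟨s, hs, hQR⟩ := pauli_comm_sign hR hQ
      obtain ⟨P, hP, hPQ⟩ := exists_pauli_diag hQ hs
      have := hψ P hP (by
        rw [hPQ, e, mulVec_mulVec, ← smul_mulVec, ← hQR, ← mulVec_mulVec, e])
      rw [hPQ, join_inj] at this
      exact this.1
    obtain ⟨s, hs, hRR⟩ := pauli_mul_self_sign hR
    obtain ⟨P, hP, hPQ⟩ := exists_pauli_anti (sign_smul_mem hR hs) hs
    have := hψ P hP (by
      rw [hPQ, mulVec_mulVec, smul_mul, hRR, smul_smul, hs.mul_self, one_smul, one_mulVec,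
        ← smul_mulVec, smul_smul, hs.mul_self, one_smul])
    rw [hPQ, join_inj, ← smul_mulVec, smul_smul, hs.mul_self, one_smul] at this
    exact ⟨c, by rw [← this.2, smul_join, mulVec_smul]⟩

/-- Stabilizers of a block are extended to stabilizers of the whole ket, so uniqueness descends to
the block. -/
theorem exists_canon {n : ℕ} {φ : Ket n} (h0 : φ ≠ 0) (h : IsStabilized φ) :
    ∃ (k : ℕ) (χ : Ket n) (c : ℂ), Canon n k χ ∧ c ≠ 0 ∧ φ = c • χ := by
  induction n with
  | zero =>
    have e : φ = φ ![] • 1 := funext fun x => by simp [Subsingleton.elim x ![]]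
    refine ⟨0, 1, φ ![], .one, fun hφ => h0 ?_, e⟩
    rw [e, hφ, zero_smul]
  | succ n ih =>
    obtain ⟨a, b, rfl⟩ := exists_join φ
    by_cases hb : b = 0
    · subst hb
      have ha : a ≠ 0 := by
        rintro rfl
        exact h0 join_zero_zero
      obtain ⟨k, χ, c, hχ, hc, rfl⟩ := ih ha fun ψ hψ => by
        obtain ⟨c, hc⟩ := h (join ψ 0) fun P hP e => by
          obtain ⟨Q, hQ, s, hs, hPQ | hPQ⟩ := pauli_block hP
          · rw [hPQ, join_inj] at e
            rw [hPQ, mulVec_zero, smul_zero, hψ Q hQ e.1]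
          · rw [hPQ, mulVec_zero, join_inj] at e
            exact absurd e.1.symm ha
        rw [smul_join, join_inj] at hc
        exact ⟨c, hc.1⟩
      exact ⟨k, _, c, hχ.left, hc, by rw [smul_join, smul_zero]⟩
    by_cases ha : a = 0
    · subst ha
      obtain ⟨k, χ, c, hχ, hc, rfl⟩ := ih hb fun ψ hψ => by
        obtain ⟨c, hc⟩ := h (join 0 ψ) fun P hP e => by
          obtain ⟨Q, hQ, s, hs, hPQ | hPQ⟩ := pauli_block hP
          · rw [hPQ, join_inj, ← smul_mulVec] at e
            rw [hPQ, mulVec_zero, ← smul_mulVec, hψ _ (sign_smul_mem hQ hs) e.2]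
          · rw [hPQ, mulVec_zero, smul_zero, join_inj] at e
            exact absurd e.2.symm hb
        rw [smul_join, join_inj] at hc
        exact ⟨c, hc.2⟩
      exact ⟨k, _, c, hχ.right, hc, by rw [smul_join, smul_zero]⟩
    -- If no Pauli maps `a` to `b`, no antidiagonal Pauli fixes `a ⊕ b`. Then `a ⊕ 0` is fixed by
    -- every stabilizer without being a multiple of `a ⊕ b`.
    have hanti : ∃ R ∈ pauliGroup n, b = R *ᵥ a := by
      by_contra! hcon
      obtain ⟨c, hc⟩ := h (join a 0) fun P hP e => by
        obtain ⟨Q, hQ, s, hs, hPQ | hPQ⟩ := pauli_block hP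
        · rw [hPQ, join_inj] at e
          rw [hPQ, mulVec_zero, smul_zero, e.1]
        · rw [hPQ, join_inj, ← smul_mulVec] at e
          exact absurd e.2.symm (hcon _ (sign_smul_mem hQ hs))
      rw [smul_join, join_inj] at hc
      rcases smul_eq_zero.1 hc.2.symm with rfl | h'
      · exact ha (by rw [hc.1, zero_smul])
      · exact hb h'
    obtain ⟨R, hR, rfl⟩ := hanti
    obtain ⟨k, χ, c, hχ, hc, rfl⟩ := ih ha fun ψ hψ => by
      obtain ⟨c, hc⟩ := h (join ψ (R *ᵥ ψ)) fun P hP e => by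
        obtain ⟨Q, hQ, s, hs, hPQ | hPQ⟩ := pauli_block hP
        · rw [hPQ, join_inj, ← smul_mulVec, mulVec_mulVec] at e
          rw [hPQ, ← smul_mulVec, mulVec_mulVec, hψ Q hQ e.1,
            hψ.mulVec_eq (mul_mem_pauliGroup (sign_smul_mem hQ hs) hR) hR e.2]
        · rw [hPQ, join_inj, ← smul_mulVec, mulVec_mulVec] at e
          rw [hPQ, ← smul_mulVec, mulVec_mulVec, hψ _ (mul_mem_pauliGroup hQ hR) e.1,
            hψ.mulVec_eq (sign_smul_mem hQ hs) hR e.2]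
      rw [smul_join, join_inj] at hc
      exact ⟨c, hc.1⟩
    exact ⟨k + 1, _, c, hχ.both hR, hc, by rw [smul_join, mulVec_smul]⟩

/-! ### Sizes of Pauli orbits. -/

/-- The orbit of a ket under the Pauli group. -/
def orbit {n : ℕ} (φ : Ket n) : Set (Ket n) := {v | ∃ P ∈ pauliGroup n, v = P *ᵥ φ}

theorem orbit_join_zero {n : ℕ} {χ : Ket n} :
    orbit (join χ 0) = (fun v => join v 0) '' orbit χ ∪ (fun v => join 0 v) '' orbit χ := by
  ext w
  constructor
  · rintro ⟨P, hP, rfl⟩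
    obtain ⟨Q, hQ, s, hs, h | h⟩ := pauli_block hP
    · exact Or.inl ⟨_, ⟨Q, hQ, rfl⟩, by simp [h _ _]⟩
    · exact Or.inr ⟨_, ⟨_, sign_smul_mem hQ hs, rfl⟩, by simp [h _ _, smul_mulVec]⟩
  · rintro (⟨_, ⟨Q, hQ, rfl⟩, rfl⟩ | ⟨_, ⟨Q, hQ, rfl⟩, rfl⟩)
    · obtain ⟨P, hP, h⟩ := exists_pauli_diag hQ (Or.inl rfl)
      exact ⟨P, hP, by simp [h _ _]⟩
    · obtain ⟨P, hP, h⟩ := exists_pauli_anti hQ (Or.inl rfl)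
      exact ⟨P, hP, by simp [h _ _]⟩

theorem orbit_zero_join {n : ℕ} {χ : Ket n} :
    orbit (join 0 χ) = (fun v => join v 0) '' orbit χ ∪ (fun v => join 0 v) '' orbit χ := by
  ext w
  constructor
  · rintro ⟨P, hP, rfl⟩
    obtain ⟨Q, hQ, s, hs, h | h⟩ := pauli_block hP
    · exact Or.inr ⟨_, ⟨_, sign_smul_mem hQ hs, rfl⟩, by simp [h _ _, smul_mulVec]⟩
    · exact Or.inl ⟨_, ⟨Q, hQ, rfl⟩, by simp [h _ _]⟩
  · rintro (⟨_, ⟨Q, hQ, rfl⟩, rfl⟩ | ⟨_, ⟨Q, hQ, rfl⟩, rfl⟩)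
    · obtain ⟨P, hP, h⟩ := exists_pauli_anti hQ (Or.inl rfl)
      exact ⟨P, hP, by simp [h _ _]⟩
    · obtain ⟨P, hP, h⟩ := exists_pauli_diag hQ (Or.inl rfl)
      exact ⟨P, hP, by simp [h _ _]⟩

theorem join_zero_injective {n : ℕ} : Function.Injective fun v : Ket n => join v 0 :=
  fun _ _ h => (join_inj.1 h).1

theorem zero_join_injective {n : ℕ} : Function.Injective fun v : Ket n => join 0 v :=
  fun _ _ h => (join_inj.1 h).2

theorem disjoint_join {n : ℕ} {S T : Set (Ket n)} (hS : ∀ v ∈ S, v ≠ 0) :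
    Disjoint ((fun v => join v 0) '' S) ((fun v => join 0 v) '' T) := by
  rw [Set.disjoint_left]
  rintro _ ⟨v, hv, rfl⟩ ⟨w, hw, e⟩
  exact hS v hv (join_inj.1 e).1.symm

theorem orbit_ne_zero {n : ℕ} {χ v : Ket n} (h : χ ≠ 0) (hv : v ∈ orbit χ) : v ≠ 0 := by
  obtain ⟨P, hP, rfl⟩ := hv
  exact pauli_mulVec_ne_zero hP h

theorem pauliGroup_finite (n : ℕ) : (pauliGroup n).Finite := by
  have : pauliGroup n = Set.range fun q : Fin 4 × (Fin n → Fin 4) =>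
      Complex.I ^ (q.1 : ℕ) • tensorOp fun j => pauli (q.2 j) := by
    ext P
    simp [pauliGroup, eq_comm]
  rw [this]
  exact Set.finite_range _

theorem orbit_finite {n : ℕ} (φ : Ket n) : (orbit φ).Finite := by
  have : orbit φ = (fun P : Op n => P *ᵥ φ) '' pauliGroup n := by
    ext v
    simp [orbit, eq_comm]
  rw [this]
  exact (pauliGroup_finite n).image _

/-- Both `P` and `Q` commute with `R` up to a sign. -/
theorem mulVec_mulVec_sign {n : ℕ} {χ : Ket n} {P Q R : Op n} (hP : P ∈ pauliGroup n)
    (hQ : Q ∈ pauliGroup n) (hR : R ∈ pauliGroup n) (h : P *ᵥ χ = Q *ᵥ χ) :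
    ∃ s, IsSign s ∧ P *ᵥ R *ᵥ χ = s • Q *ᵥ R *ᵥ χ := by
  obtain ⟨s, hs, hPR⟩ := pauli_comm_sign hP hR
  obtain ⟨t, ht, hRQ⟩ := pauli_comm_sign hR hQ
  refine ⟨s * t, hs.mul ht, ?_⟩
  rw [mulVec_mulVec, hPR, smul_mulVec, ← mulVec_mulVec, h, mulVec_mulVec, hRQ, smul_mulVec, smul_smul,
    mulVec_mulVec]

/-- An orbit element is determined by its upper block `v` in the orbit of `χ` and a sign: once a
Pauli `p v` with `p v χ = v` is chosen, the lower block is `± p v R χ`, and both signs occur. -/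
theorem ncard_orbit_both {n : ℕ} {χ : Ket n} {R : Op n} (h0 : χ ≠ 0) (hR : R ∈ pauliGroup n) :
    (orbit (join χ (R *ᵥ χ))).ncard = 2 * (orbit χ).ncard := by
  classical
  have hex : ∀ v, ∃ P, v ∈ orbit χ → P ∈ pauliGroup n ∧ v = P *ᵥ χ := fun v => by
    by_cases hv : v ∈ orbit χ
    · obtain ⟨P, hP⟩ := hv
      exact ⟨P, fun _ => hP⟩
    · exact ⟨0, fun h => absurd h hv⟩
  choose p hp using hex
  have himg : orbit (join χ (R *ᵥ χ)) =
      (fun q : Ket n × ℂ => join q.1 (q.2 • p q.1 *ᵥ R *ᵥ χ)) '' (orbit χ ×ˢ {1, -1}) := by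
    ext w
    constructor
    · rintro ⟨P, hP, rfl⟩
      obtain ⟨Q, hQ, s, hs, h | h⟩ := pauli_block hP
      · have hv : Q *ᵥ χ ∈ orbit χ := ⟨Q, hQ, rfl⟩
        obtain ⟨t, ht, e⟩ := mulVec_mulVec_sign hQ (hp _ hv).1 hR (hp _ hv).2
        refine ⟨(Q *ᵥ χ, s * t), ⟨hv, hs.mul ht⟩, ?_⟩
        simp only [h _ _, e, smul_smul]
      -- The upper block is now `QRχ`. As `R² = r` with `r` a sign, the lower block `Qχ` is `r (QR)
      -- Rχ` up to the sign `s`.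
      · have hv : Q *ᵥ R *ᵥ χ ∈ orbit χ :=
          ⟨Q * R, mul_mem_pauliGroup hQ hR, by rw [mulVec_mulVec]⟩
        obtain ⟨t, ht, e⟩ := mulVec_mulVec_sign (mul_mem_pauliGroup hQ hR) (hp _ hv).1 hR
          (by rw [← mulVec_mulVec, ← (hp _ hv).2])
        obtain ⟨r, hr, hRR⟩ := pauli_mul_self_sign hR
        refine ⟨(Q *ᵥ R *ᵥ χ, s * (r * t)), ⟨hv, hs.mul (hr.mul ht)⟩, ?_⟩
        rw [mulVec_mulVec, mul_assoc, hRR, mul_smul_comm, mul_one, smul_mulVec] at e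
        simp only [h _ _, mul_smul, ← e]
        rw [smul_smul r r, hr.mul_self, one_smul]
    · rintro ⟨⟨v, s⟩, ⟨hv, hs⟩, rfl⟩
      obtain ⟨P, hP, h⟩ := exists_pauli_diag (hp v hv).1 hs
      exact ⟨P, hP, by rw [h, ← (hp v hv).2]⟩
  rw [himg, Set.InjOn.ncard_image, Set.ncard_prod, Set.ncard_pair (by norm_num), mul_comm]
  rintro ⟨v, s⟩ ⟨hv, hs⟩ ⟨w, t⟩ ⟨hw, ht⟩ e
  obtain ⟨e1, e2⟩ := join_inj.1 e
  obtain rfl : v = w := e1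
  rw [Prod.mk.injEq]
  exact ⟨rfl, smul_left_injective ℂ
    (pauli_mulVec_ne_zero (hp v hv).1 (pauli_mulVec_ne_zero hR h0)) e2⟩

theorem ncard_orbit_one : (orbit (1 : Ket 0)).ncard = 4 := by
  have : orbit (1 : Ket 0) =
      (fun c : ℂ => c • (1 : Ket 0)) '' ({1, Complex.I, -1, -Complex.I} : Finset ℂ) := by
    ext v
    simp only [orbit, pauliGroup, Set.mem_ofPred_eq, Set.mem_image, Finset.coe_insert,
      Finset.coe_singleton]
    constructor
    · rintro ⟨_, ⟨k, p, rfl⟩, rfl⟩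
      refine ⟨Complex.I ^ (k : ℕ), ?_, ?_⟩
      · fin_cases k <;> simp [Complex.I_pow_three]
      · ext x
        simp [mulVec, dotProduct, tensorOp]
    · rintro ⟨c, hc, rfl⟩
      have : ∃ k : Fin 4, c = Complex.I ^ (k : ℕ) := by
        rcases hc with rfl | rfl | rfl | rfl
        · exact ⟨0, by simp⟩
        · exact ⟨1, by simp⟩
        · exact ⟨2, by simp⟩
        · exact ⟨3, by simp [Complex.I_pow_three]⟩
      obtain ⟨k, rfl⟩ := this
      refine ⟨_, ⟨k, ![], rfl⟩, ?_⟩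
      ext x
      simp [mulVec, dotProduct, tensorOp]
  rw [this, Set.ncard_image_of_injective _ (smul_left_injective ℂ one_ne_zero),
    Set.ncard_coe_finset]
  have h1 : (1 : ℂ) ∉ ({Complex.I, -1, -Complex.I} : Finset ℂ) := by
    norm_num [Complex.ext_iff]
  have h2 : Complex.I ∉ ({-1, -Complex.I} : Finset ℂ) := by
    norm_num [Complex.ext_iff]
  have h3 : (-1 : ℂ) ∉ ({-Complex.I} : Finset ℂ) := by
    norm_num [Complex.ext_iff]
  rw [Finset.card_insert_of_notMem h1, Finset.card_insert_of_notMem h2,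
    Finset.card_insert_of_notMem h3, Finset.card_singleton]

/-- Each qubit doubles the orbit; the extra `2 ^ 2` counts the four global phases. -/
theorem Canon.ncard_orbit {n k : ℕ} {χ : Ket n} (h : Canon n k χ) :
    (orbit χ).ncard = 2 ^ (n + 2) := by
  induction h with
  | one => simp [ncard_orbit_one]
  | @left n k χ h ih =>
    rw [orbit_join_zero, Set.ncard_union_eq (disjoint_join fun v hv => orbit_ne_zero h.ne_zero hv)
      ((orbit_finite χ).image _) ((orbit_finite χ).image _),
      Set.ncard_image_of_injective _ join_zero_injective,
      Set.ncard_image_of_injective _ zero_join_injective, ih]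
    ring
  | @right n k χ h ih =>
    rw [orbit_zero_join, Set.ncard_union_eq (disjoint_join fun v hv => orbit_ne_zero h.ne_zero hv)
      ((orbit_finite χ).image _) ((orbit_finite χ).image _),
      Set.ncard_image_of_injective _ join_zero_injective,
      Set.ncard_image_of_injective _ zero_join_injective, ih]
    ring
  | both h hR ih =>
    rw [ncard_orbit_both h.ne_zero hR, ih]
    ring

/-! ### Counting canonical kets. -/

/-- The kets of the form `χ ⊕ Pχ`, with `χ` in a given set and `P` a Pauli operator. -/
def doubled {n : ℕ} (S : Set (Ket n)) : Set (Ket (n + 1)) :=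
  {φ | ∃ χ ∈ S, ∃ v ∈ orbit χ, φ = join χ v}

theorem doubled_finite {n : ℕ} {S : Set (Ket n)} (hS : S.Finite) : (doubled S).Finite := by
  have : doubled S = ⋃ χ ∈ S, (fun v => join χ v) '' orbit χ := by
    ext φ
    simp [doubled, eq_comm]
  rw [this]
  exact hS.biUnion fun χ _ => (orbit_finite χ).image _

theorem ncard_doubled {n : ℕ} {S : Set (Ket n)} (hS : S.Finite)
    (h : ∀ χ ∈ S, (orbit χ).ncard = 2 ^ (n + 2)) :
    (doubled S).ncard = 2 ^ (n + 2) * S.ncard := by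
  classical
  have himg : doubled S =
      (fun q : (_ : Ket n) × Ket n => join q.1 q.2) ''
        (hS.toFinset.sigma fun χ => (orbit_finite χ).toFinset : Finset ((_ : Ket n) × Ket n)) := by
    ext φ
    simp [doubled, eq_comm, and_assoc]
  rw [himg, Set.ncard_image_of_injective, Set.ncard_coe_finset, Finset.card_sigma,
    Finset.sum_congr rfl (g := fun _ => 2 ^ (n + 2)), Finset.sum_const, ← Set.ncard_eq_toFinset_card S hS,
    smul_eq_mul, mul_comm]
  · intro χ hχ
    rw [← Set.ncard_eq_toFinset_card _ (orbit_finite χ), h χ (hS.mem_toFinset.1 hχ)]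
  · rintro ⟨a, b⟩ ⟨c, d⟩ e
    obtain ⟨rfl, rfl⟩ := join_inj.1 e
    rfl

/-- The canonical stabilizer kets with support of size `2 ^ k`. -/
def canonKets (n k : ℕ) : Set (Ket n) := {χ | Canon n k χ}

/-- The canonical stabilizer kets. -/
def allCanonKets (n : ℕ) : Set (Ket n) := {χ | ∃ k, Canon n k χ}

theorem allCanonKets_zero : allCanonKets 0 = {1} := by
  ext χ
  constructor
  · rintro ⟨k, h⟩
    cases h
    rfl
  · rintro rfl
    exact ⟨0, .one⟩

theorem allCanonKets_succ (n : ℕ) : allCanonKets (n + 1) =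
    ((fun v => join v 0) '' allCanonKets n ∪ (fun v => join 0 v) '' allCanonKets n) ∪
      doubled (allCanonKets n) := by
  ext χ
  constructor
  · rintro ⟨k, h⟩
    cases h with
    | left h => exact Or.inl (Or.inl ⟨_, ⟨_, h⟩, rfl⟩)
    | right h => exact Or.inl (Or.inr ⟨_, ⟨_, h⟩, rfl⟩)
    | both h hP => exact Or.inr ⟨_, ⟨_, h⟩, _, ⟨_, hP, rfl⟩, rfl⟩
  · rintro ((⟨_, ⟨_, h⟩, rfl⟩ | ⟨_, ⟨_, h⟩, rfl⟩) | ⟨_, ⟨_, h⟩, _, ⟨_, hP, rfl⟩, rfl⟩)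
    exacts [⟨_, h.left⟩, ⟨_, h.right⟩, ⟨_, h.both hP⟩]

theorem allCanonKets_finite (n : ℕ) : (allCanonKets n).Finite := by
  induction n with
  | zero => simp [allCanonKets_zero]
  | succ n ih =>
    rw [allCanonKets_succ]
    exact ((ih.image _).union (ih.image _)).union (doubled_finite ih)

/-- The two one-block forms contribute `2` and the doubled form `2 ^ (n + 2)`; the three are
disjoint because canonical kets and their orbits avoid zero. -/
theorem ncard_allCanonKets_succ (n : ℕ) :
    (allCanonKets (n + 1)).ncard = 2 * (2 ^ (n + 1) + 1) * (allCanonKets n).ncard := by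
  have hfin := allCanonKets_finite n
  have h0 : ∀ χ ∈ allCanonKets n, χ ≠ 0 := by
    rintro χ ⟨k, h⟩
    exact h.ne_zero
  rw [allCanonKets_succ, Set.ncard_union_eq _ ((hfin.image _).union (hfin.image _))
    (doubled_finite hfin), Set.ncard_union_eq (disjoint_join h0) (hfin.image _) (hfin.image _),
    Set.ncard_image_of_injective _ join_zero_injective,
    Set.ncard_image_of_injective _ zero_join_injective, ncard_doubled hfin]
  · ring
  · rintro χ ⟨k, h⟩
    exact h.ncard_orbit
  · rw [Set.disjoint_left]
    rintro _ (⟨v, hv, rfl⟩ | ⟨v, hv, rfl⟩) ⟨χ, hχ, w, hw, e⟩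
    · exact orbit_ne_zero (h0 χ hχ) hw (join_inj.1 e).2.symm
    · exact h0 χ hχ (join_inj.1 e).1.symm

theorem ncard_allCanonKets (n : ℕ) :
    (allCanonKets n).ncard = 2 ^ n * ∏ j ∈ Finset.Icc 1 n, (2 ^ j + 1) := by
  induction n with
  | zero => simp [allCanonKets_zero]
  | succ n ih =>
    rw [ncard_allCanonKets_succ, ih, Finset.prod_Icc_succ_top (by omega)]
    ring

/-! ### Counting by size of support. -/

theorem canonKets_finite (n k : ℕ) : (canonKets n k).Finite :=
  (allCanonKets_finite n).subset fun _ h => ⟨k, h⟩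

theorem ncard_canonKets_succ_zero (n : ℕ) :
    (canonKets (n + 1) 0).ncard ≤ 2 * (canonKets n 0).ncard := by
  have hfin := canonKets_finite n 0
  have hsub : canonKets (n + 1) 0 ⊆
      (fun v => join v 0) '' canonKets n 0 ∪ (fun v => join 0 v) '' canonKets n 0 := by
    intro χ h
    generalize hk : 0 = k at h
    cases h with
    | left h => exact Or.inl ⟨_, hk ▸ h, rfl⟩
    | right h => exact Or.inr ⟨_, hk ▸ h, rfl⟩
    | both h hP => omega
  refine (Set.ncard_le_ncard hsub ((hfin.image _).union (hfin.image _))).trans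
    ((Set.ncard_union_le _ _).trans ?_)
  rw [two_mul]
  exact add_le_add (Set.ncard_image_le hfin) (Set.ncard_image_le hfin)

theorem ncard_canonKets_succ_succ (n k : ℕ) :
    (canonKets (n + 1) (k + 1)).ncard ≤
      2 * (canonKets n (k + 1)).ncard + 2 ^ (n + 2) * (canonKets n k).ncard := by
  have hfin := canonKets_finite n (k + 1)
  have hsub : canonKets (n + 1) (k + 1) ⊆
      ((fun v => join v 0) '' canonKets n (k + 1) ∪ (fun v => join 0 v) '' canonKets n (k + 1)) ∪
        doubled (canonKets n k) := by
    intro χ h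
    cases h with
    | left h => exact Or.inl (Or.inl ⟨_, h, rfl⟩)
    | right h => exact Or.inl (Or.inr ⟨_, h, rfl⟩)
    | both h hP => exact Or.inr ⟨_, h, _, ⟨_, hP, rfl⟩, rfl⟩
  refine (Set.ncard_le_ncard hsub (((hfin.image _).union (hfin.image _)).union
    (doubled_finite (canonKets_finite n k)))).trans ((Set.ncard_union_le _ _).trans ?_)
  rw [ncard_doubled (canonKets_finite n k) fun χ h => h.ncard_orbit, two_mul]
  gcongr
  exact (Set.ncard_union_le _ _).trans
    (add_le_add (Set.ncard_image_le hfin) (Set.ncard_image_le hfin))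

/-- From `(n, k)` to `(n + 1, k + 1)` the quantity `kn - k² / 2` grows by `n + 1 / 2`. The `3n`
supplies three more units: two for the surplus in `2 ^ (n + 2)` and one for adding two terms. -/
theorem ncard_canonKets_le (n k : ℕ) :
    ((canonKets n k).ncard : ℝ) ≤ (2 : ℝ) ^ ((k : ℝ) * n - (k : ℝ) ^ 2 / 2 + 3 * n) := by
  induction n generalizing k with
  | zero =>
    rcases k with _ | k
    · have : canonKets 0 0 ⊆ {1} := fun χ h => by cases h; rfl
      have := Set.ncard_le_ncard this
      rw [Set.ncard_singleton] at this
      simpa using this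
    · have : canonKets 0 (k + 1) = ∅ := Set.eq_empty_of_forall_notMem fun χ h => by cases h
      rw [this, Set.ncard_empty, Nat.cast_zero]
      positivity
  | succ n ih =>
    rcases k with _ | k
    · have h := ncard_canonKets_succ_zero n
      have h' : ((canonKets (n + 1) 0).ncard : ℝ) ≤ 2 * (canonKets n 0).ncard := by exact_mod_cast h
      refine h'.trans ((mul_le_mul_of_nonneg_left (ih 0) zero_le_two).trans ?_)
      nth_rw 1 [← Real.rpow_one (2 : ℝ)]
      rw [← Real.rpow_add zero_lt_two]
      apply Real.rpow_le_rpow_of_exponent_le one_le_two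
      push_cast
      linarith
    · have h := ncard_canonKets_succ_succ n k
      have h' : ((canonKets (n + 1) (k + 1)).ncard : ℝ) ≤
          2 * (canonKets n (k + 1)).ncard + 2 ^ (n + 2) * (canonKets n k).ncard := by
        exact_mod_cast h
      have hk := ih k
      have hk' := ih (k + 1)
      set e : ℝ := ((k + 1 : ℕ) : ℝ) * ((n + 1 : ℕ) : ℝ) - ((k + 1 : ℕ) : ℝ) ^ 2 / 2 +
        3 * ((n + 1 : ℕ) : ℝ) with he
      have h1 : (2 : ℝ) * (canonKets n (k + 1)).ncard ≤ (2 : ℝ) ^ (e - 1) := by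
        refine (mul_le_mul_of_nonneg_left hk' zero_le_two).trans ?_
        nth_rw 1 [← Real.rpow_one (2 : ℝ)]
        rw [← Real.rpow_add zero_lt_two]
        apply Real.rpow_le_rpow_of_exponent_le one_le_two
        rw [he]
        push_cast
        have : (0 : ℝ) ≤ k := k.cast_nonneg
        linarith
      have h2 : (2 : ℝ) ^ (n + 2) * (canonKets n k).ncard ≤ (2 : ℝ) ^ (e - 1) := by
        refine (mul_le_mul_of_nonneg_left hk (by positivity)).trans ?_
        rw [← Real.rpow_natCast, ← Real.rpow_add zero_lt_two]
        apply Real.rpow_le_rpow_of_exponent_le one_le_two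
        rw [he]
        push_cast
        nlinarith
      have h3 : (2 : ℝ) ^ e = 2 ^ (e - 1) + 2 ^ (e - 1) := by
        rw [Real.rpow_sub_one two_ne_zero]
        ring
      rw [h3]
      linarith

/-! ### From kets to states. -/

/-- The pure state `|χ⟩⟨χ| / ⟨χ|χ⟩`. -/
noncomputable def state {n : ℕ} (χ : Ket n) : Op n := (star χ ⬝ᵥ χ)⁻¹ • vecMulVec χ (star χ)

theorem star_dotProduct_self {n : ℕ} (χ : Ket n) :
    star χ ⬝ᵥ χ = ((∑ x, ‖χ x‖ ^ 2 : ℝ) : ℂ) := by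
  simp [dotProduct, ← Complex.conj_mul']

theorem sum_norm_sq_pos {n : ℕ} {χ : Ket n} (h : χ ≠ 0) : 0 < ∑ x, ‖χ x‖ ^ 2 := by
  obtain ⟨y, hy⟩ := Function.ne_iff.1 h
  exact Finset.sum_pos' (fun _ _ => by positivity) ⟨y, Finset.mem_univ _,
    pow_pos (norm_pos_iff.2 hy) 2⟩

theorem state_smul {n : ℕ} (χ : Ket n) {c : ℂ} (hc : c ≠ 0) : state (c • χ) = state χ := by
  have hc' : star c ≠ 0 := star_ne_zero.2 hc
  simp only [state, star_smul, smul_dotProduct, dotProduct_smul, smul_vecMulVec, vecMulVec_smul,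
    smul_smul, smul_eq_mul]
  congr 1
  field_simp

/-- Any column `y` of the projector with `χ y ≠ 0` recovers `χ` up to a scalar. -/
theorem eq_smul_of_state_eq {n : ℕ} {χ ξ : Ket n} (hχ : χ ≠ 0)
    (h : state χ = state ξ) : ∃ c : ℂ, c ≠ 0 ∧ χ = c • ξ := by
  obtain ⟨y, hy⟩ := Function.ne_iff.1 hχ
  have hy' : star (χ y) ≠ 0 := star_ne_zero.2 hy
  have hn : star χ ⬝ᵥ χ ≠ 0 := by
    rw [star_dotProduct_self]
    exact Complex.ofReal_ne_zero.2 (sum_norm_sq_pos hχ).ne'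
  have e : χ = ((star χ ⬝ᵥ χ) * (star ξ ⬝ᵥ ξ)⁻¹ * star (ξ y) / star (χ y)) • ξ := by
    ext x
    have := congrFun (congrFun h x) y
    simp only [state, Matrix.smul_apply, vecMulVec_apply, Pi.star_apply, smul_eq_mul] at this
    rw [inv_mul_eq_iff_eq_mul₀ hn] at this
    rw [Pi.smul_apply, smul_eq_mul, div_mul_eq_mul_div, eq_div_iff hy', this]
    ring
  refine ⟨_, fun hc => hχ ?_, e⟩
  rw [e, hc, zero_smul]

theorem stabilizerStates_eq (n : ℕ) : stabilizerStates n = state '' allCanonKets n := by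
  ext ρ
  constructor
  · rintro ⟨φ, hφ, rfl⟩
    obtain ⟨h1, h2⟩ := isStabilizerKet_iff.1 hφ
    have h0 : φ ≠ 0 := by
      rintro rfl
      simp at h1
    obtain ⟨k, χ, c, hχ, hc, rfl⟩ := exists_canon h0 h2
    refine ⟨χ, ⟨k, hχ⟩, ?_⟩
    rw [← state_smul χ hc, state, h1, inv_one, one_smul]
  · rintro ⟨χ, ⟨k, hχ⟩, rfl⟩
    have hpos := sum_norm_sq_pos hχ.ne_zero
    have hdot := star_dotProduct_self χ
    set N := ∑ x, ‖χ x‖ ^ 2 with hN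
    have hs : (((Real.sqrt N)⁻¹ : ℝ) : ℂ) ≠ 0 := by
      simpa using (Real.sqrt_pos.2 hpos).ne'
    have hsq : (((Real.sqrt N)⁻¹ : ℝ) : ℂ) * (((Real.sqrt N)⁻¹ : ℝ) : ℂ) = ((N⁻¹ : ℝ) : ℂ) := by
      rw [← Complex.ofReal_mul, ← mul_inv, Real.mul_self_sqrt hpos.le]
    have hone : star ((((Real.sqrt N)⁻¹ : ℝ) : ℂ) • χ) ⬝ᵥ ((((Real.sqrt N)⁻¹ : ℝ) : ℂ) • χ) = 1 := by
      rw [star_smul, smul_dotProduct, dotProduct_smul, hdot, smul_eq_mul, smul_eq_mul, ← mul_assoc,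
        show star (((Real.sqrt N)⁻¹ : ℝ) : ℂ) = (((Real.sqrt N)⁻¹ : ℝ) : ℂ) from
          Complex.conj_ofReal _, hsq, ← Complex.ofReal_mul, inv_mul_cancel₀ hpos.ne',
        Complex.ofReal_one]
    refine ⟨(((Real.sqrt N)⁻¹ : ℝ) : ℂ) • χ, isStabilizerKet_iff.2 ⟨hone, hχ.isStabilized.smul hs⟩, ?_⟩
    rw [← state_smul χ hs, state, hone, inv_one, one_smul]

theorem state_injOn (n : ℕ) : Set.InjOn state (allCanonKets n) := by
  rintro χ ⟨k, hχ⟩ ξ ⟨l, hξ⟩ e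
  obtain ⟨c, hc, rfl⟩ := eq_smul_of_state_eq hχ.ne_zero e
  have h := hχ.lead_eq_one
  rw [lead_smul _ hc, hξ.lead_eq_one, mul_one] at h
  rw [h, one_smul]

theorem numStab_eq (n : ℕ) : numStab n = 2 ^ n * ∏ j ∈ Finset.Icc 1 n, (2 ^ j + 1) := by
  rw [numStab, stabilizerStates_eq, (state_injOn n).ncard_image, ncard_allCanonKets]

/-! ### Amplitudes and supports of canonical kets. -/

theorem Canon.norm_apply {n k : ℕ} {χ : Ket n} (h : Canon n k χ) (x : Bits n) :
    χ x = 0 ∨ ‖χ x‖ = 1 := by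
  induction h with
  | one => simp
  | left _ ih =>
    revert x
    exact forall_bits_succ.2 ⟨fun x => by simpa using ih x, fun x => by simp⟩
  | right _ ih =>
    revert x
    exact forall_bits_succ.2 ⟨fun x => by simp, fun x => by simpa using ih x⟩
  | @both n k χ P _ hP ih =>
    obtain ⟨a, ha⟩ := exists_norm_pauli_mulVec hP
    revert x
    refine forall_bits_succ.2 ⟨fun x => by simpa using ih x, fun x => ?_⟩
    rw [join_cons_one, ← norm_eq_zero, ha, norm_eq_zero]
    exact ih _

/-- The support is an affine subspace over `𝔽₂`, expressed by closure under sums of three points.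
Doubling joins `S` to a translate `S + a`, which preserves this because `a + a = 0`. -/
theorem Canon.apply_add_add_ne_zero {n k : ℕ} {χ : Ket n} (h : Canon n k χ) (x y z : Bits n)
    (hx : χ x ≠ 0) (hy : χ y ≠ 0) (hz : χ z ≠ 0) : χ (x + y + z) ≠ 0 := by
  have cons_add : ∀ {n : ℕ} (b c : Fin 2) (x y : Bits n), (Fin.cons b x : Bits (n + 1)) +
      (Fin.cons c y : Bits (n + 1)) = (Fin.cons (b + c) (x + y) : Bits (n + 1)) := by
    intro n b c x y
    ext i
    refine Fin.cases ?_ (fun i => ?_) i <;> simp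
  have h2 : (1 : Fin 2) + 1 = 0 := rfl
  induction h with
  | one => simp
  | left _ ih =>
    revert x y z
    simp only [forall_bits_succ, cons_add, join_cons_zero, join_cons_one, add_zero,
      Pi.zero_apply, ne_eq, not_true, false_imp_iff, imp_true_iff, and_true]
    exact ih
  | right _ ih =>
    revert x y z
    simp only [forall_bits_succ, cons_add, join_cons_zero, join_cons_one, zero_add,
      Pi.zero_apply, ne_eq, not_true, false_imp_iff, imp_true_iff, true_and, h2]
    exact ih
  | @both n k χ P _ hP ih =>
    obtain ⟨a, ha⟩ := exists_norm_pauli_mulVec hP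
    have hne : ∀ x, (P *ᵥ χ) x ≠ 0 ↔ χ (x + a) ≠ 0 := fun x => by
      rw [← norm_ne_zero_iff, ha, norm_ne_zero_iff]
    have haa : a + a = 0 := by
      ext i
      generalize h : a i = c
      fin_cases c <;> simp [h]
    revert x y z
    simp only [forall_bits_succ, cons_add, join_cons_zero, join_cons_one, add_zero, zero_add, h2, hne]
    -- Eight cases for the first bits. Shifts by `a` cancel in pairs, and one survives exactly when
    -- the first bit of the sum is `1`.
    refine ⟨fun x => ⟨fun y => ⟨fun z => ih x y z, fun z hx hy hz => ?_⟩, fun y =>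
      ⟨fun z hx hy hz => ?_, fun z hx hy hz => ?_⟩⟩, fun x => ⟨fun y => ⟨fun z hx hy hz => ?_,
      fun z hx hy hz => ?_⟩, fun y => ⟨fun z hx hy hz => ?_, fun z hx hy hz => ?_⟩⟩⟩
    · convert ih _ _ _ hx hy hz using 2; abel
    · convert ih _ _ _ hx hy hz using 2; abel
    · convert ih _ _ _ hx hy hz using 2
      rw [show x + (y + a) + (z + a) = x + y + z + (a + a) by abel, haa, add_zero]
    · convert ih _ _ _ hx hy hz using 2; abel
    · convert ih _ _ _ hx hy hz using 2
      rw [show x + a + y + (z + a) = x + y + z + (a + a) by abel, haa, add_zero]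
    · convert ih _ _ _ hx hy hz using 2
      rw [show x + a + (y + a) + z = x + y + z + (a + a) by abel, haa, add_zero]
    · convert ih _ _ _ hx hy hz using 2
      rw [show x + a + (y + a) + (z + a) = x + y + z + a + (a + a) by abel, haa, add_zero]

/-- As the nonzero moduli are `1`, this sum counts the support; in this form it is plainly invariant
under the translation and phases of a Pauli. -/
theorem Canon.sum_norm {n k : ℕ} {χ : Ket n} (h : Canon n k χ) : ∑ x, ‖χ x‖ = 2 ^ k := by
  induction h with
  | one => simp
  | left _ ih => simp [sum_bits_succ, ih]
  | right _ ih => simp [sum_bits_succ, ih]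
  | @both n k χ P _ hP ih =>
    obtain ⟨a, ha⟩ := exists_norm_pauli_mulVec hP
    simp only [sum_bits_succ, join_cons_zero, join_cons_one, ha, ih]
    rw [show ∑ x, ‖χ (x + a)‖ = _ from Equiv.sum_comp (Equiv.addRight a) fun x => ‖χ x‖, ih]
    ring

/-- The support of a ket. -/
noncomputable def supp {n : ℕ} (χ : Ket n) : Finset (Bits n) := {x | χ x ≠ 0}

theorem mem_supp {n : ℕ} {χ : Ket n} {x : Bits n} : x ∈ supp χ ↔ χ x ≠ 0 := by
  simp [supp]

theorem Canon.card_supp {n k : ℕ} {χ : Ket n} (h : Canon n k χ) : (supp χ).card = 2 ^ k := by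
  have : ((supp χ).card : ℝ) = 2 ^ k := by
    rw [← h.sum_norm, ← Finset.sum_subset (Finset.subset_univ (supp χ)), Finset.card_eq_sum_ones,
      Nat.cast_sum]
    · refine Finset.sum_congr rfl fun x hx => ?_
      rw [(h.norm_apply x).resolve_left (mem_supp.1 hx), Nat.cast_one]
    · intro x _ hx
      rw [mem_supp, not_not] at hx
      rw [hx, norm_zero]
  exact_mod_cast this

/-! ### Affine sets of constant weight. -/

/-- The positions at which a string is `1`. -/
def ones {n : ℕ} (x : Bits n) : Finset (Fin n) := {i | x i = 1}

theorem mem_ones {n : ℕ} {x : Bits n} {i : Fin n} : i ∈ ones x ↔ x i = 1 := by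
  simp [ones]

theorem eq_zero_or_one (c : Fin 2) : c = 0 ∨ c = 1 := by
  fin_cases c <;> simp

theorem ones_injective {n : ℕ} : Function.Injective (ones (n := n)) := by
  intro x y h
  ext i
  have := Finset.ext_iff.1 h i
  rw [mem_ones, mem_ones] at this
  rcases eq_zero_or_one (x i) with hx | hx <;> rcases eq_zero_or_one (y i) with hy | hy <;>
    simp_all

theorem add_add_eq (a b c : Fin 2) : (a = b → a + b + c = c) ∧ (a + b + c = c → a = b) := by
  revert a b c
  decide

/-- An affine family of strings of constant weight in `n` bits has at most `2 ^ (n / 2)` members. -/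
theorem card_sq_le_of_constant_weight {n w : ℕ} {A : Finset (Bits n)}
    (hadd : ∀ x ∈ A, ∀ y ∈ A, ∀ z ∈ A, x + y + z ∈ A) (hw : ∀ x ∈ A, (ones x).card = w) :
    A.card ^ 2 ≤ 2 ^ n := by
  classical
  rcases A.eq_empty_or_nonempty with rfl | ⟨y, hy⟩
  · simp
  have key : ∀ x ∈ A, ∀ z ∈ A, x + z + y = y → x = z := by
    intro x _ z _ e
    ext i
    rw [(add_add_eq (x i) (z i) (y i)).2 (congrFun e i)]
  -- If `x` and `z` agree on the ones of `y`, then `x + z + y` contains all of these ones. Equal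
  -- weight makes it `y`, so `x = z`.
  have h1 : A.card ≤ 2 ^ (ones y).card := by
    rw [← Finset.card_powerset]
    refine Finset.card_le_card_of_injOn (fun x => ones x ∩ ones y)
      (fun x _ => Finset.mem_coe.2 (Finset.mem_powerset.2 Finset.inter_subset_right)) ?_
    intro x hx z hz e
    have hxz := hadd x hx z hz y hy
    refine key x hx z hz (ones_injective (Finset.eq_of_subset_of_card_le ?_ ?_).symm)
    · intro i hi
      have hi' := Finset.ext_iff.1 e i
      simp only [Finset.mem_inter, hi, and_true, mem_ones] at hi'
      rw [mem_ones] at hi ⊢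
      have : x i = z i := by
        rcases eq_zero_or_one (x i) with hx | hx <;> rcases eq_zero_or_one (z i) with hz | hz <;>
          simp_all
      exact ((add_add_eq _ _ _).1 this).trans hi
    · rw [hw _ hxz, hw _ hy]
  -- Dually, agreement off the ones of `y` makes `x + z + y` contained in `y`, and equal weight
  -- again gives `x = z`.
  have h2 : A.card ≤ 2 ^ (n - (ones y).card) := by
    rw [show n - (ones y).card = (ones y)ᶜ.card by rw [Finset.card_compl, Fintype.card_fin],
      ← Finset.card_powerset]
    refine Finset.card_le_card_of_injOn (fun x => ones x ∩ (ones y)ᶜ)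
      (fun x _ => Finset.mem_coe.2 (Finset.mem_powerset.2 Finset.inter_subset_right)) ?_
    intro x hx z hz e
    have hxz := hadd x hx z hz y hy
    refine key x hx z hz (ones_injective (Finset.eq_of_subset_of_card_le ?_ ?_))
    · intro i hi
      by_contra hiy
      have hi' := Finset.ext_iff.1 e i
      simp only [Finset.mem_inter, Finset.mem_compl, hiy, not_false_iff, and_true, mem_ones] at hi'
      rw [mem_ones] at hi hiy
      have : x i = z i := by
        rcases eq_zero_or_one (x i) with hx | hx <;> rcases eq_zero_or_one (z i) with hz | hz <;>
          simp_all
      exact hiy (((add_add_eq _ _ _).1 this).symm.trans hi)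
    · rw [hw _ hxz, hw _ hy]
  have h3 : (ones y).card ≤ n := by
    simpa using Finset.card_le_univ (ones y)
  calc A.card ^ 2 = A.card * A.card := sq _
    _ ≤ 2 ^ (ones y).card * 2 ^ (n - (ones y).card) := Nat.mul_le_mul h1 h2
    _ = 2 ^ n := by rw [← pow_add, Nat.add_sub_cancel' h3]

/-! ### The polytope inequality and amplitude damping. -/

theorem Canon.norm_apply_le {n k : ℕ} {χ : Ket n} (h : Canon n k χ) (x y : Bits n) :
    ‖χ x‖ * ‖χ y‖ ≤ ‖χ y‖ ^ 2 := by
  rcases h.norm_apply y with hy | hy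
  · simp [hy]
  · rcases h.norm_apply x with hx | hx <;> simp [hx, hy]

theorem state_apply {n : ℕ} (χ : Ket n) (x y : Bits n) :
    state χ x y = (((∑ x, ‖χ x‖ ^ 2)⁻¹ : ℝ) : ℂ) * (χ x * star (χ y)) := by
  rw [state, star_dotProduct_self, Complex.ofReal_inv]
  rfl

/-- In the stabilizer polytope, each diagonal entry dominates its column. -/
theorem norm_apply_le_of_mem_stabilizerPolytope {n : ℕ} {ρ : Op n} (h : ρ ∈ stabilizerPolytope n)
    (x y : Bits n) : ‖ρ x y‖ ≤ (ρ y y).re := by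
  -- The condition is convex in `ρ`, so it need only be checked on pure stabilizer states.
  have hconv : Convex ℝ {ρ : Op n | ‖ρ x y‖ ≤ (ρ y y).re} := by
    intro ρ hρ σ hσ a b ha hb _
    simp only [Set.mem_ofPred_eq] at hρ hσ ⊢
    simp only [Matrix.add_apply, Matrix.smul_apply, Complex.add_re, Complex.real_smul,
      Complex.re_ofReal_mul]
    refine (norm_add_le _ _).trans ?_
    rw [norm_mul, norm_mul, Complex.norm_of_nonneg ha, Complex.norm_of_nonneg hb]
    gcongr
  refine convexHull_min (fun σ hσ => ?_) hconv h
  rw [stabilizerStates_eq] at hσ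
  obtain ⟨χ, ⟨k, hχ⟩, rfl⟩ := hσ
  have hpos := sum_norm_sq_pos hχ.ne_zero
  rw [Set.mem_ofPred_eq, state_apply, state_apply, Complex.re_ofReal_mul, norm_mul, norm_mul,
    norm_star, Complex.norm_of_nonneg (inv_nonneg.2 hpos.le),
    show χ y * star (χ y) = ((‖χ y‖ ^ 2 : ℝ) : ℂ) by simpa using Complex.mul_conj' (χ y),
    Complex.ofReal_re]
  exact mul_le_mul_of_nonneg_left (hχ.norm_apply_le x y) (inv_nonneg.2 hpos.le)

theorem krausBranch_empty_mulVec {n : ℕ} (γ : ℝ) (φ : Ket n) (x : Bits n) :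
    (krausBranch γ ∅ *ᵥ φ) x = (Real.sqrt (1 - γ) : ℂ) ^ (ones x).card * φ x := by
  rw [mulVec, dotProduct, Finset.sum_eq_single x]
  · congr 1
    simp only [krausBranch, tensorOp, of_apply, Finset.notMem_empty, if_false]
    rw [ones, ← Finset.prod_const, Finset.prod_filter]
    refine Finset.prod_congr rfl fun i _ => ?_
    rcases eq_zero_or_one (x i) with hx | hx <;> simp [hx, krausE0]
  · intro z _ hz
    obtain ⟨i, hi⟩ := Function.ne_iff.1 hz
    refine mul_eq_zero_of_left ?_ _
    simp only [krausBranch, tensorOp, of_apply, Finset.notMem_empty, if_false]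
    refine Finset.prod_eq_zero (Finset.mem_univ i) ?_
    rcases eq_zero_or_one (x i) with hx | hx <;> rcases eq_zero_or_one (z i) with hz | hz <;>
      simp_all [krausE0]
  · simp

/-- A branch with a jump reaches `y` only from strings that strictly contain the ones of `y`, and
these are too heavy to lie in the support. -/
theorem krausBranch_mulVec_eq_zero {n : ℕ} (γ : ℝ) {J : Finset (Fin n)} (hJ : J.Nonempty)
    {φ : Ket n} {y : Bits n} (hy : ∀ z, φ z ≠ 0 → (ones z).card ≤ (ones y).card) :
    (krausBranch γ J *ᵥ φ) y = 0 := by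
  refine Finset.sum_eq_zero fun z _ => ?_
  by_contra hne
  obtain ⟨h1, h2⟩ := mul_ne_zero_iff.1 hne
  simp only [krausBranch, tensorOp, of_apply, Finset.prod_ne_zero_iff, Finset.mem_univ,
    true_implies] at h1
  obtain ⟨j, hj⟩ := hJ
  refine (hy z h2).not_gt (Finset.card_lt_card ((Finset.ssubset_iff_of_subset fun i hi => ?_).2
    ⟨j, ?_, ?_⟩))
  · rw [mem_ones] at hi ⊢
    have := h1 i
    rcases eq_zero_or_one (z i) with hz | hz
    · split_ifs at this <;> simp [hi, hz, krausE0, krausE1] at this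
    · exact hz
  · rw [mem_ones]
    have := h1 j
    rw [if_pos hj] at this
    rcases eq_zero_or_one (z j) with hz | hz
    · rcases eq_zero_or_one (y j) with hy | hy <;> simp [hz, hy, krausE1] at this
    · exact hz
  · rw [mem_ones]
    intro hyj
    have := h1 j
    rw [if_pos hj, hyj] at this
    rcases eq_zero_or_one (z j) with hz | hz <;> simp [hz, krausE1] at this

theorem amplitudeDamping_state_apply {n : ℕ} (γ : ℝ) {χ : Ket n} (x : Bits n) {y : Bits n}
    (hy : ∀ z, χ z ≠ 0 → (ones z).card ≤ (ones y).card) :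
    amplitudeDamping γ (state χ) x y = ((Real.sqrt (1 - γ) ^ ((ones x).card + (ones y).card) : ℝ) : ℂ) *
      state χ x y := by
  have hterm : ∀ J : Finset (Fin n),
      (krausBranch γ J * state χ * (krausBranch γ J).conjTranspose) x y =
        (star χ ⬝ᵥ χ)⁻¹ * ((krausBranch γ J *ᵥ χ) x * star ((krausBranch γ J *ᵥ χ) y)) := by
    intro J
    rw [state, Matrix.mul_smul, Matrix.smul_mul, mul_vecMulVec, vecMulVec_mul, ← star_mulVec]
    rfl
  rw [amplitudeDamping, Matrix.sum_apply, Finset.sum_eq_single ∅]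
  · rw [hterm, krausBranch_empty_mulVec, krausBranch_empty_mulVec, state_apply,
      star_dotProduct_self, star_mul', star_pow,
      show star ((Real.sqrt (1 - γ) : ℝ) : ℂ) = (Real.sqrt (1 - γ) : ℂ) from Complex.conj_ofReal _,
      Complex.ofReal_pow, Complex.ofReal_inv, pow_add]
    ring
  · intro J _ hJ
    rw [hterm, krausBranch_mulVec_eq_zero γ (Finset.nonempty_iff_ne_empty.2 hJ) hy, star_zero,
      mul_zero, mul_zero]
  · simp

theorem Canon.constant_weight {n k : ℕ} {χ : Ket n} (h : Canon n k χ)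
    (hins : amplitudeDamping (3 / 4) (state χ) ∈ stabilizerPolytope n) :
    ∃ w, ∀ x ∈ supp χ, (ones x).card = w := by
  have hne : (supp χ).Nonempty := by
    obtain ⟨y, hy⟩ := Function.ne_iff.1 h.ne_zero
    exact ⟨y, mem_supp.2 hy⟩
  obtain ⟨y, hy, hmax⟩ := Finset.exists_max_image (supp χ) (fun x => (ones x).card) hne
  refine ⟨(ones y).card, fun x hx => le_antisymm (hmax x hx) ?_⟩
  have hle := norm_apply_le_of_mem_stabilizerPolytope hins x y
  have hy' : ∀ z, χ z ≠ 0 → (ones z).card ≤ (ones y).card := fun z hz => hmax z (mem_supp.2 hz)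
  have hpos := inv_pos.2 (sum_norm_sq_pos h.ne_zero)
  -- The choice `γ = 3 / 4` gives damping factor `1 / 2`; any factor strictly between `0` and `1`
  -- would force `|y| ≤ |x|` in the same way.
  have hsqrt : Real.sqrt (1 - 3 / 4) = 1 / 2 := by
    rw [Real.sqrt_eq_iff_mul_self_eq] <;> norm_num
  have hyn := (h.norm_apply y).resolve_left (mem_supp.1 hy)
  rw [amplitudeDamping_state_apply _ _ hy', amplitudeDamping_state_apply _ _ hy', state_apply,
    state_apply, hsqrt, norm_mul, norm_mul, norm_mul, norm_star, Complex.re_ofReal_mul,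
    Complex.re_ofReal_mul, Complex.norm_of_nonneg (by positivity), Complex.norm_of_nonneg hpos.le,
    show χ y * star (χ y) = ((‖χ y‖ ^ 2 : ℝ) : ℂ) by simpa using Complex.mul_conj' (χ y),
    Complex.ofReal_re, hyn, (h.norm_apply x).resolve_left (mem_supp.1 hx), one_pow, mul_one,
    mul_le_mul_iff_left₀ (by simpa using hpos),
    pow_le_pow_iff_right_of_lt_one₀ (by norm_num) (by norm_num)] at hle
  omega

/-! ### Numerical bounds. -/

theorem magicInsulators_subset (n : ℕ) :
    magicInsulators n ⊆ ⋃ k ∈ Finset.range (n / 2 + 1), state '' canonKets n k := by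
  rintro ρ ⟨hρ, hins⟩
  rw [stabilizerStates_eq] at hρ
  obtain ⟨χ, ⟨k, hχ⟩, rfl⟩ := hρ
  obtain ⟨w, hw⟩ := hχ.constant_weight (hins (3 / 4) ⟨by norm_num, by norm_num⟩)
  have := card_sq_le_of_constant_weight (fun x hx y hy z hz => mem_supp.2
    (hχ.apply_add_add_ne_zero x y z (mem_supp.1 hx) (mem_supp.1 hy) (mem_supp.1 hz))) hw
  rw [hχ.card_supp, ← pow_mul, Nat.pow_le_pow_iff_right (by norm_num)] at this
  exact Set.mem_biUnion (Finset.mem_coe.2 (Finset.mem_range.2 (by omega))) ⟨χ, hχ, rfl⟩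

theorem numIns_le_sum (n : ℕ) :
    numIns n ≤ ∑ k ∈ Finset.range (n / 2 + 1), (canonKets n k).ncard := by
  refine (Set.ncard_le_ncard (magicInsulators_subset n) ?_).trans
    ((Finset.set_ncard_biUnion_le _ _).trans ?_)
  · exact (Finset.finite_toSet _).biUnion fun k _ => (canonKets_finite n k).image _
  · exact Finset.sum_le_sum fun k _ => Set.ncard_image_le (canonKets_finite n k)

theorem numIns_le (n : ℕ) : (numIns n : ℝ) ≤ (2 : ℝ) ^ (3 * (n : ℝ) ^ 2 / 8 + 4 * n) := by
  calc (numIns n : ℝ) ≤ ∑ k ∈ Finset.range (n / 2 + 1), ((canonKets n k).ncard : ℝ) := by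
        exact_mod_cast numIns_le_sum n
    _ ≤ ∑ k ∈ Finset.range (n / 2 + 1), (2 : ℝ) ^ (3 * (n : ℝ) ^ 2 / 8 + 3 * n) := by
        refine Finset.sum_le_sum fun k hk => (ncard_canonKets_le n k).trans ?_
        apply Real.rpow_le_rpow_of_exponent_le one_le_two
        have hk' : 2 * k ≤ n := by
          have := Finset.mem_range.1 hk
          omega
        have hk'' : 2 * (k : ℝ) ≤ n := by exact_mod_cast hk'
        have hk0 : (0 : ℝ) ≤ k := k.cast_nonneg
        -- The exponent `kn - k² / 2` increases for `k ≤ n`, and equals `3n² / 8` at `k = n / 2`.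
        nlinarith
    _ = ((n / 2 + 1 : ℕ) : ℝ) * (2 : ℝ) ^ (3 * (n : ℝ) ^ 2 / 8 + 3 * n) := by
        rw [Finset.sum_const, Finset.card_range, nsmul_eq_mul]
    -- The number of values of `k` is absorbed at the cost of one more `n` in the exponent.
    _ ≤ (2 : ℝ) ^ (n : ℝ) * (2 : ℝ) ^ (3 * (n : ℝ) ^ 2 / 8 + 3 * n) := by
        gcongr
        have : n / 2 + 1 ≤ 2 ^ n := by
          have := Nat.lt_two_pow_self (n := n)
          omega
        rw [Real.rpow_natCast]
        exact_mod_cast this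
    _ = (2 : ℝ) ^ (3 * (n : ℝ) ^ 2 / 8 + 4 * n) := by
        rw [← Real.rpow_add zero_lt_two]
        congr 1
        ring

theorem prod_two_pow (n : ℕ) :
    ∏ j ∈ Finset.Icc 1 n, (2 : ℝ) ^ j = (2 : ℝ) ^ ((n : ℝ) ^ 2 / 2 + n / 2) := by
  induction n with
  | zero => simp
  | succ n ih =>
    rw [Finset.prod_Icc_succ_top (by omega), ih, ← Real.rpow_natCast 2 (n + 1), ← Real.rpow_add zero_lt_two]
    congr 1
    push_cast
    ring

theorem le_numStab (n : ℕ) : (2 : ℝ) ^ ((n : ℝ) ^ 2 / 2) ≤ numStab n := by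
  rw [numStab_eq]
  push_cast
  calc (2 : ℝ) ^ ((n : ℝ) ^ 2 / 2) ≤ (2 : ℝ) ^ ((n : ℝ) ^ 2 / 2 + n / 2) := by
        apply Real.rpow_le_rpow_of_exponent_le one_le_two
        have : (0 : ℝ) ≤ n := n.cast_nonneg
        linarith
    _ = 1 * ∏ j ∈ Finset.Icc 1 n, (2 : ℝ) ^ j := by rw [prod_two_pow, one_mul]
    _ ≤ 2 ^ n * ∏ j ∈ Finset.Icc 1 n, ((2 : ℝ) ^ j + 1) := by
        gcongr
        · exact one_le_pow₀ one_le_two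
        · linarith

theorem numStab_le (n : ℕ) : (numStab n : ℝ) ≤ (2 : ℝ) ^ ((n : ℝ) ^ 2 / 2 + 5 / 2 * n) := by
  rw [numStab_eq]
  push_cast
  calc 2 ^ n * ∏ j ∈ Finset.Icc 1 n, ((2 : ℝ) ^ j + 1)
      -- Linear terms: `n` from the prefactor, `n` from these factors `2`, and `n / 2` from the sum
      -- of the exponents `j`.
      ≤ 2 ^ n * ∏ j ∈ Finset.Icc 1 n, (2 * (2 : ℝ) ^ j) := by
        gcongr with j
        have : (1 : ℝ) ≤ 2 ^ j := one_le_pow₀ one_le_two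
        linarith
    _ = (2 : ℝ) ^ ((n : ℝ) ^ 2 / 2 + 5 / 2 * n) := by
        rw [Finset.prod_mul_distrib, prod_two_pow, Finset.prod_const, Nat.card_Icc,
          Nat.add_sub_cancel, ← Real.rpow_natCast, ← Real.rpow_add zero_lt_two,
          ← Real.rpow_add zero_lt_two]
        congr 1
        ring

end MagicInsulator

theorem mainTheorem8 :
    (∀ n : ℕ, MagicInsulator.numStab n = 2 ^ n * ∏ j ∈ Finset.Icc 1 n, (2 ^ j + 1)) ∧
    (∃ C : ℝ, ∀ n : ℕ,
      (2 : ℝ) ^ ((n : ℝ) ^ 2 / 2 - C * n) ≤ (MagicInsulator.numStab n : ℝ) ∧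
      (MagicInsulator.numStab n : ℝ) ≤ (2 : ℝ) ^ ((n : ℝ) ^ 2 / 2 + C * n)) ∧
    (∃ C : ℝ, ∀ n : ℕ,
      (MagicInsulator.numIns n : ℝ) / (MagicInsulator.numStab n : ℝ) ≤
        (2 : ℝ) ^ (-((n : ℝ) ^ 2) / 8 + C * n)) := by
  refine ⟨MagicInsulator.numStab_eq, ⟨5 / 2, fun n => ⟨?_, MagicInsulator.numStab_le n⟩⟩,
    ⟨4, fun n => ?_⟩⟩
  · refine (Real.rpow_le_rpow_of_exponent_le one_le_two ?_).trans (MagicInsulator.le_numStab n)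
    have : (0 : ℝ) ≤ n := n.cast_nonneg
    linarith
  · have hpos : (0 : ℝ) < 2 ^ ((n : ℝ) ^ 2 / 2) := by positivity
    rw [div_le_iff₀ (hpos.trans_le (MagicInsulator.le_numStab n))]
    -- The exponents match exactly, since `3 / 8 = -1 / 8 + 1 / 2`; the constant `4` is inherited
    -- from `numIns_le`.
    refine (MagicInsulator.numIns_le n).trans (le_trans (le_of_eq ?_)
      (mul_le_mul_of_nonneg_left (MagicInsulator.le_numStab n) (by positivity)))
    rw [← Real.rpow_add zero_lt_two]
    congr 1
    ring
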